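/- An $(n,m,d,k)$-grid colouring is a function $W:\mathbb Z^d\to\mathcal A$ with $|\mathcal A|=k$ such that $W_{\mathbf x+n\mathbf e_j}=W_{\mathbf x}$ for all $\mathbf x\in\mathbb Z^d$ and all $j$ (periodicity), and such that, for all $\mathbf x,\mathbf y\in\mathbb Z^d$, if the multisets of colours of $(W_{\mathbf x+\mathbf c})_{\mathbf c\in[0,m-1]^d}$ and of $(W_{\mathbf y+\mathbf c})_{\mathbf c\in[0,m-1]^d}$ are equal, then $x_j\equiv y_j \bmod n$ for all $j$ (injectivity). **Theorem.** Fix a dimension $d\ge 2$ and a number of colours $k=bd+1$ with an integer $b\ge 1$. For every positive window size $m$ that is a multiple of $2(k-1)$ there are a size $n=n(m)$ and an $(n,m,d,k)$-grid colouring $W=W^{(m)}$ with colours $\{0,\dots,k-1\}$, such that, as $m\to\infty$ through the multiples of $2(k-1)$, \[ n\sim C_k^{1/d}\,m^{k-1},\qquad C_k=\Big(\frac{1}{k-1}\Big)^{k-1}. \] The colouring is explicit: $n$ can be computed from $m$, and for every $\mathbf x\in\mathbb Z^d$ the colour $W_{\mathbf x}$ can be computed from $m$ and $\mathbf x$, with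 $O_{k,d}(1)$ arithmetic operations. Furthermore, for every $\mathbf x\in\mathbb Z^d$, given $m$ and the multiset of colours in $(W_{\mathbf x+\mathbf c})_{\mathbf c\in[0,m-1]^d}$ (that is, the number of occurrences of each colour), one can compute $\mathbf x \bmod n$ with $O_{k,d}(1)$ arithmetic operations. Here each of the three algorithms is a single program that depends only on $d$ and $k$ and not on $m$; it works on integer registers, and an operation is the storing of a constant or the copying of a register, an addition, subtraction, multiplication, integer division or remainder, or a comparison of two registers. -/

import Mathlib

open Filter Asymptotics

/-! ### Torus packings and grid colourings -/

/-- The pattern `(W_{x + c})`, `c ∈ [0, m-1]^d`, of the window of size `m` with corner `x`. -/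
def windowPattern {A : Type*} {d : ℕ} (W : (Fin d → ℤ) → A) (m : ℕ) (x : Fin d → ℤ) :
    (Fin d → Fin m) → A :=
  fun c => W (fun j => x j + ((c j : ℕ) : ℤ))

/-- `W : ℤ^d → A` is an `(A, f, n, m, d)`-torus packing, where `f` is a function on
`A^{m^d}`. -/
structure IsTorusPacking {A B : Type*} (n m d : ℕ) (f : ((Fin d → Fin m) → A) → B)
    (W : (Fin d → ℤ) → A) : Prop where
  periodic : ∀ (x : Fin d → ℤ) (j : Fin d), W (x + Pi.single j (n : ℤ)) = W x
  injective : ∀ x y : Fin d → ℤ,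
    f (windowPattern W m x) = f (windowPattern W m y) → ∀ j, x j ≡ y j [ZMOD (n : ℤ)]

/-- The multiset of the entries of a finite family. -/
def entryMultiset {ι A : Type*} [Fintype ι] (g : ι → A) : Multiset A :=
  Finset.univ.val.map g

/-- `(n, m, d, k)`-grid colourings, with `Fin k` as the alphabet of `k` colours. -/
def IsGridColouring (n m d k : ℕ) (W : (Fin d → ℤ) → Fin k) : Prop :=
  IsTorusPacking n m d entryMultiset W

/-! ### A machine model that counts arithmetic operations

Structured programs over integer registers, with unit cost for every elementary instruction
(storing a constant, copying a register, one arithmetic operation) and for every evaluation of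
a test. -/

/-- Arithmetic operations on integers. -/
inductive ArithOp where
  | add
  | sub
  | mul
  | quo
  | rem

/-- `quo` and `rem` are integer division and its remainder: for `b > 0` they are `⌊a / b⌋`
and `a mod b ∈ [0, b-1]`. -/
def ArithOp.eval : ArithOp → ℤ → ℤ → ℤ
  | .add, a, b => a + b
  | .sub, a, b => a - b
  | .mul, a, b => a * b
  | .quo, a, b => a / b
  | .rem, a, b => a % b

/-- Programs; the natural numbers are names of registers. The test of `ite` and of `loop`
(a while loop) is `register r ≤ register s`. -/
inductive Prog where
  | skip
  | const (r : ℕ) (z : ℤ)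
  | copy (r s : ℕ)
  | arith (o : ArithOp) (r s t : ℕ)
  | seq (P Q : Prog)
  | ite (r s : ℕ) (P Q : Prog)
  | loop (r s : ℕ) (P : Prog)

/-- `Prog.Runs P σ τ t`: started with register contents `σ`, the program `P` halts with
register contents `τ` after `t` operations. -/
inductive Prog.Runs : Prog → (ℕ → ℤ) → (ℕ → ℤ) → ℕ → Prop where
  | skip (σ : ℕ → ℤ) : Runs .skip σ σ 0
  | const (σ : ℕ → ℤ) (r : ℕ) (z : ℤ) : Runs (.const r z) σ (Function.update σ r z) 1
  | copy (σ : ℕ → ℤ) (r s : ℕ) : Runs (.copy r s) σ (Function.update σ r (σ s)) 1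
  | arith (σ : ℕ → ℤ) (o : ArithOp) (r s t : ℕ) :
      Runs (.arith o r s t) σ (Function.update σ r (o.eval (σ s) (σ t))) 1
  | seq {P Q : Prog} {σ τ υ : ℕ → ℤ} {p q : ℕ} (hP : Runs P σ τ p) (hQ : Runs Q τ υ q) :
      Runs (.seq P Q) σ υ (p + q)
  | ite_true {r s : ℕ} {P Q : Prog} {σ τ : ℕ → ℤ} {p : ℕ} (h : σ r ≤ σ s)
      (hP : Runs P σ τ p) : Runs (.ite r s P Q) σ τ (p + 1)
  | ite_false {r s : ℕ} {P Q : Prog} {σ τ : ℕ → ℤ} {q : ℕ} (h : ¬ σ r ≤ σ s)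
      (hQ : Runs Q σ τ q) : Runs (.ite r s P Q) σ τ (q + 1)
  | loop_true {r s : ℕ} {P : Prog} {σ τ υ : ℕ → ℤ} {p q : ℕ} (h : σ r ≤ σ s)
      (hP : Runs P σ τ p) (hL : Runs (.loop r s P) τ υ q) :
      Runs (.loop r s P) σ υ (p + q + 1)
  | loop_false {r s : ℕ} {P : Prog} {σ : ℕ → ℤ} (h : ¬ σ r ≤ σ s) :
      Runs (.loop r s P) σ σ 1

/-- The initial register contents: the input in the first registers, then zeros. -/
def loadInput {p : ℕ} (v : Fin p → ℤ) : ℕ → ℤ :=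
  fun i => if h : i < p then v ⟨i, h⟩ else 0

/-- On input `v` the program `P` halts after at most `K` operations, with the entries of `w`
in its first registers. -/
def Prog.ComputesWithin {p q : ℕ} (P : Prog) (K : ℕ) (v : Fin p → ℤ) (w : Fin q → ℤ) : Prop :=
  ∃ (τ : ℕ → ℤ) (t : ℕ), P.Runs (loadInput v) τ t ∧ t ≤ K ∧ ∀ i : Fin q, τ i = w i

/-! Put K = bd = k - 1. Each cell is reserved for the colour congruent to its coordinate sum modulo
K, and shows either that colour or the filler colour K. The K other colours form d groups of b, one
group per direction. As K divides m, a slice of a window orthogonal to direction j has exactly M =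
m^(d-1)/K cells reserved for a given colour, and a threshold on `sliceCode` makes exactly a
prescribed number of them visible, wherever the window lies (`card_window_code_div_lt`). So the
count of colour (j, l) is a window sum of the sequence `levelSeq` number l in the coordinate x_j
alone (`count_gridColouring`), and the problem becomes one-dimensional.

Sequence 0 falls by 2 per block of length m, down to 0, then climbs to M. An extra 1 on the first
cell of each falling block makes the window sum odd or even according to the branch; on each branch
the sum moves in steps of 2, so it gives the position modulo mM (`decodePosition_zero`). Sequence l
+ 1 carries a counter s in [0, mM], constant on stretches of length N = `levelPeriod m M l` and
spread over every block of length m. Once the position modulo N is known, the window sum determines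
s, even across the end of a stretch (`decodePosition_succ`).

Thus n = mM(mM+1)^(b-1) with mM = m^d/K, which gives the asymptotics. All formulas are loop-free
arithmetic terms of size depending only on d and b, and `exists_prog_of_isArith` compiles them. -/

/-! ### Periodic integer sequences that are determined by their window sums -/

/-- A window of length `m` starting at `m * q + r` meets the block `q` and the block `q + 1`. -/
theorem sum_window_eq_add (f : ℤ → ℤ) {m r : ℕ} (hr : r ≤ m) (q : ℤ) :
    ∑ c ∈ Finset.range m, f (m * q + r + c) =
      ∑ i ∈ Finset.range r, f (m * (q + 1) + i) + ∑ i ∈ Finset.Ico r m, f (m * q + i) := by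
  obtain ⟨s, rfl⟩ := Nat.exists_eq_add_of_le hr
  rw [Finset.sum_Ico_eq_sum_range, Nat.add_sub_cancel_left, add_comm r s,
    Finset.sum_range_add, add_comm]
  congr 1
  · refine Finset.sum_congr rfl fun i _ => congrArg f ?_
    push_cast; ring
  · refine Finset.sum_congr rfl fun i _ => congrArg f ?_
    push_cast; ring

/-- The period of the first `l + 1` sequences together. -/
def levelPeriod (m M : ℤ) (l : ℕ) : ℤ := m * M * (m * M + 1) ^ l

/-- The sequences number `0, 1, 2, …`; the window sums of sequence `0` determine the position
modulo `m * M`, and those of sequence `l + 1` lift it from modulus `levelPeriod m M l` to modulus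
`levelPeriod m M (l + 1)`. -/
def levelSeq (m M : ℤ) : ℕ → ℤ → ℤ
  | 0, t =>
    if 2 * (t % (m * M) / m) + 2 ≤ M then
      M - 2 - 2 * (t % (m * M) / m) + (if t % m ≤ 0 then 1 else 0)
    else 2 * (t % (m * M) / m) - M + 2
  | l + 1, t =>
    max 0 (min M ((t / levelPeriod m M l) % (m * M + 1) - M * (m - 1 - t % m)))

/-- The position modulo `levelPeriod m M l`, recovered from the window sums `A 0, …, A l`. -/
def decodePosition (m M : ℤ) (A : ℕ → ℤ) : ℕ → ℤ
  | 0 =>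
    if A 0 % 2 ≤ 0 then m * (M / 2 - 1) + A 0 / 2 else (m * (M - 2) + 1 - A 0) / 2 % (m * M)
  | l + 1 =>
    levelPeriod m M l *
        (if A (l + 1) + 1 ≤
            M * (m - max 0 (decodePosition m M A l - (levelPeriod m M l - m))) then A (l + 1)
          else if A (l + 1) ≤
            M * (m - max 0 (decodePosition m M A l - (levelPeriod m M l - m))) then m * M
          else A (l + 1) - 1) +
      decodePosition m M A l

/-! ### Periods and bounds of the level sequences -/

theorem levelPeriod_pos {m M : ℤ} (hm : 0 < m) (hM : 0 < M) (l : ℕ) : 0 < levelPeriod m M l := by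
  unfold levelPeriod; positivity

theorem levelPeriod_succ (m M : ℤ) (l : ℕ) :
    levelPeriod m M (l + 1) = levelPeriod m M l * (m * M + 1) := by
  unfold levelPeriod; ring

theorem dvd_levelPeriod (m M : ℤ) (l : ℕ) : m ∣ levelPeriod m M l :=
  ⟨M * (m * M + 1) ^ l, by unfold levelPeriod; ring⟩

theorem levelPeriod_dvd (m M : ℤ) {l l' : ℕ} (h : l ≤ l') :
    levelPeriod m M l ∣ levelPeriod m M l' :=
  mul_dvd_mul_left _ (pow_dvd_pow _ h)

theorem levelSeq_nonneg {m M : ℤ} (hm : 0 < m) (hM : 0 < M) (l : ℕ) (t : ℤ) :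
    0 ≤ levelSeq m M l t := by
  cases l with
  | zero =>
    have := Int.ediv_nonneg (Int.emod_nonneg t (mul_pos hm hM).ne') hm.le
    simp only [levelSeq]
    split_ifs <;> omega
  | succ l => exact le_max_left _ _

theorem levelSeq_le {m M : ℤ} (hm : 0 < m) (hM : 0 < M) (l : ℕ) (t : ℤ) :
    levelSeq m M l t ≤ M := by
  cases l with
  | zero =>
    have := Int.ediv_nonneg (Int.emod_nonneg t (mul_pos hm hM).ne') hm.le
    have : t % (m * M) / m < M := by
      rw [Int.ediv_lt_iff_lt_mul hm, mul_comm M]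
      exact Int.emod_lt_of_pos t (mul_pos hm hM)
    simp only [levelSeq]
    split_ifs <;> omega
  | succ l => exact max_le hM.le (min_le_left _ _)

theorem Int.emod_mul_eq {a b c : ℤ} (hb : 0 < b) (hc : 0 < c) :
    a % (b * c) = b * (a / b % c) + a % b := by
  have h1 := Int.emod_nonneg a hb.ne'
  have h2 := Int.emod_lt_of_pos a hb
  have h3 := Int.emod_nonneg (a / b) hc.ne'
  have h4 := Int.emod_lt_of_pos (a / b) hc
  have e1 := Int.emod_add_mul_ediv a b
  have e2 := Int.emod_add_mul_ediv (a / b) c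
  have : a = (b * (a / b % c) + a % b) + b * c * (a / b / c) := by
    linear_combination (-1 : ℤ) * e1 - b * e2
  conv_lhs => rw [this, Int.add_mul_emod_self_left]
  exact Int.emod_eq_of_lt (by positivity) (by nlinarith)

theorem levelSeq_add_period {m M : ℤ} (hm : 0 < m) (hM : 0 < M) {l l' : ℕ} (h : l ≤ l') (t : ℤ) :
    levelSeq m M l (t + levelPeriod m M l') = levelSeq m M l t := by
  have hmod : (t + levelPeriod m M l') % m = t % m := by
    obtain ⟨z, hz⟩ := dvd_levelPeriod m M l'
    rw [hz, Int.add_mul_emod_self_left]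
  cases l with
  | zero =>
    have h0 : (t + levelPeriod m M l') % (m * M) = t % (m * M) :=
      Int.add_mul_emod_self_left _ _ _
    simp only [levelSeq, h0, hmod]
  | succ l =>
    have h1 : (t + levelPeriod m M l') / levelPeriod m M l % (m * M + 1) =
        t / levelPeriod m M l % (m * M + 1) := by
      obtain ⟨z, hz⟩ := levelPeriod_dvd m M h
      rw [hz, levelPeriod_succ, mul_assoc,
        Int.add_mul_ediv_left _ _ (levelPeriod_pos hm hM l).ne', Int.add_mul_emod_self_left]
    simp only [levelSeq, h1, hmod]

/-! ### Spreading a counter over a block -/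

theorem sum_clamp_range {s M : ℤ} (hs : 0 ≤ s) (hM : 0 ≤ M) (n : ℕ) :
    ∑ i ∈ Finset.range n, max 0 (min M (s - M * i)) = min s (M * n) := by
  induction n with
  | zero => simp [hs]
  | succ n ih =>
    rw [Finset.sum_range_succ, ih]
    have : 0 ≤ M * n := by positivity
    push_cast
    rw [mul_add]
    omega

/-- A block is filled from its last cell backwards, each cell up to capacity M, so its tail takes as
much of s as fits; the head receives the overflow. -/
theorem sum_clamp_Ico {s M : ℤ} (hs : 0 ≤ s) (hM : 0 ≤ M) {r m : ℕ} (hr : r ≤ m) :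
    ∑ i ∈ Finset.Ico r m, max 0 (min M (s - M * (m - 1 - i))) = min s (M * (m - r)) := by
  obtain ⟨n, rfl⟩ := Nat.exists_eq_add_of_le hr
  rw [Finset.sum_Ico_eq_sum_range, Nat.add_sub_cancel_left, ← Finset.sum_range_reflect]
  have h := sum_clamp_range hs hM n
  push_cast
  rw [add_sub_cancel_left, ← h]
  refine Finset.sum_congr rfl fun i hi => ?_
  have hi' : ((n - 1 - i : ℕ) : ℤ) = n - 1 - i := by
    have := Finset.mem_range.mp hi
    omega
  rw [hi']
  congr 4
  ring

theorem sum_clamp_range_reverse {s M : ℤ} (hs : 0 ≤ s) (hM : 0 ≤ M) {r m : ℕ} (hr : r ≤ m)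
    (hsM : s ≤ m * M) :
    ∑ i ∈ Finset.range r, max 0 (min M (s - M * (m - 1 - i))) = s - min s (M * (m - r)) := by
  have h1 := sum_clamp_Ico hs hM hr
  have h2 := sum_clamp_Ico hs hM (Nat.zero_le m)
  rw [← Finset.range_eq_Ico, ← Finset.sum_range_add_sum_Ico _ hr, h1] at h2
  push_cast at h2
  rw [sub_zero, mul_comm M m, min_eq_left hsM] at h2
  linarith

/-! ### Decoding sequence 0 -/

theorem levelSeq_zero_apply {m M q i : ℤ} (hm : 0 < m) (hq : 0 ≤ q) (hqM : q < M) (w : ℤ)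
    (hi : 0 ≤ i) (him : i < m) :
    levelSeq m M 0 (m * (M * w + q) + i) =
      if 2 * q + 2 ≤ M then M - 2 - 2 * q + (if i ≤ 0 then 1 else 0) else 2 * q - M + 2 := by
  have h1 : (m * (M * w + q) + i) % m = i := by
    rw [Int.mul_add_emod_self_left, Int.emod_eq_of_lt hi him]
  have h2 : (m * (M * w + q) + i) % (m * M) = i + m * q := by
    have : m * (M * w + q) + i = (i + m * q) + m * M * w := by ring
    rw [this, Int.add_mul_emod_self_left]
    exact Int.emod_eq_of_lt (by positivity) (by nlinarith)
  have h3 : (i + m * q) / m = q := by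
    rw [Int.add_mul_ediv_left _ _ hm.ne', Int.ediv_eq_zero_of_lt hi him, zero_add]
  simp only [levelSeq, h1, h2, h3]

theorem sum_range_add_ite {r : ℕ} (α β : ℤ) :
    ∑ i ∈ Finset.range r, (α + (if (i : ℤ) ≤ 0 then β else 0)) =
      r * α + if 0 < r then β else 0 := by
  induction r with
  | zero => simp
  | succ r ih =>
    rw [Finset.sum_range_succ, ih]
    rcases Nat.eq_zero_or_pos r with rfl | hr
    · simp
    · have : ¬ (r : ℤ) ≤ 0 := by omega
      simp only [hr, this, if_true, if_false, Nat.succ_pos]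
      push_cast; ring

theorem sum_Ico_add_ite {r m : ℕ} (hr : r ≤ m) (hm : 0 < m) (α β : ℤ) :
    ∑ i ∈ Finset.Ico r m, (α + (if (i : ℤ) ≤ 0 then β else 0)) =
      (m - r) * α + if 0 < r then 0 else β := by
  have h := Finset.sum_range_add_sum_Ico (fun i : ℕ => α + (if (i : ℤ) ≤ 0 then β else 0)) hr
  rw [sum_range_add_ite, sum_range_add_ite, if_pos hm] at h
  split_ifs at h ⊢ <;> linarith

/-- The window sums of sequence `0`. -/
theorem decodePosition_zero {m : ℕ} {M : ℤ} (hm : 0 < m) (hM : 0 < M) (hM2 : 2 ∣ M) (t : ℤ)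
    (A : ℕ → ℤ) (hA : A 0 = ∑ c ∈ Finset.range m, levelSeq m M 0 (t + c)) :
    decodePosition m M A 0 = t % (m * M) := by
  have hm' : (0 : ℤ) < m := by exact_mod_cast hm
  obtain ⟨r, hrt⟩ := Int.eq_ofNat_of_zero_le (Int.emod_nonneg t hm'.ne')
  have hr : r < m := by have := Int.emod_lt_of_pos t hm'; omega
  obtain ⟨q, hq⟩ : ∃ q, q = t / m % M := ⟨_, rfl⟩
  have hq0 : 0 ≤ q := hq ▸ Int.emod_nonneg _ hM.ne'
  have hqM : q < M := hq ▸ Int.emod_lt_of_pos _ hM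
  have hT : t % (m * M) = m * q + r := by rw [Int.emod_mul_eq hm' hM, hrt, hq]
  obtain ⟨w, hw⟩ : ∃ w, w = t / m / M := ⟨_, rfl⟩
  have ht : t = m * (M * w + q) + r := by
    rw [hw, hq, Int.mul_ediv_add_emod, ← hrt, Int.mul_ediv_add_emod]
  have hS : A 0 = ∑ i ∈ Finset.range r, levelSeq m M 0 (m * (M * w + (q + 1)) + i) +
      ∑ i ∈ Finset.Ico r m, levelSeq m M 0 (m * (M * w + q) + i) := by
    rw [hA, ht, sum_window_eq_add _ hr.le]
    simp only [add_assoc]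
  have e2 : ∑ i ∈ Finset.Ico r m, levelSeq m M 0 (m * (M * w + q) + i) =
      ∑ i ∈ Finset.Ico r m, ((if 2 * q + 2 ≤ M then M - 2 - 2 * q else 2 * q - M + 2) +
        if (i : ℤ) ≤ 0 then (if 2 * q + 2 ≤ M then 1 else 0) else 0) := by
    refine Finset.sum_congr rfl fun i hi => ?_
    rw [levelSeq_zero_apply hm' hq0 hqM w (by positivity)
      (by have := Finset.mem_Ico.mp hi; omega)]
    split_ifs <;> simp
  rw [e2, sum_Ico_add_ite hr.le hm] at hS
  obtain ⟨Q, rfl⟩ := hM2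
  have e3 : (2 * Q) / 2 = Q := by omega
  rw [hT]
  simp only [decodePosition, e3]
  have hr0 : (0 : ℤ) ≤ r := by positivity
  have hrm : (r : ℤ) < m := by exact_mod_cast hr
  -- In the last block of a period the window runs on into block 0 of the next period.
  rcases eq_or_lt_of_le (Int.add_one_le_iff.mpr hqM) with hq1 | hq1
  · have e1 : ∑ i ∈ Finset.range r, levelSeq m (2 * Q) 0 (m * (2 * Q * w + (q + 1)) + i) =
        ∑ i ∈ Finset.range r, ((2 * Q - 2) + if (i : ℤ) ≤ 0 then 1 else 0) := by
      refine Finset.sum_congr rfl fun i hi => ?_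
      have : 2 * Q * w + (q + 1) = 2 * Q * (w + 1) + 0 := by rw [hq1]; ring
      rw [this, levelSeq_zero_apply hm' le_rfl hM (w + 1) (by positivity)
        (by have := Finset.mem_range.mp hi; omega)]
      rw [if_pos (by omega)]; ring
    have h2 : ¬ 2 * q + 2 ≤ 2 * Q := by omega
    rw [e1, sum_range_add_ite] at hS
    simp only [h2, if_false, ite_self] at hS
    obtain rfl : q = 2 * Q - 1 := by omega
    by_cases hr' : 0 < r
    · have hval : A 0 = 2 * (m * Q - r) + 1 := by
        rw [hS, if_pos hr']; ring
      rw [if_neg (by omega), hval]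
      -- The quotient is r - m, negative; the outer remainder adds the missing period.
      have : ((m : ℤ) * (2 * Q - 2) + 1 - (2 * (m * Q - r) + 1)) / 2 = (m * (2 * Q - 1) + r) + m * (2 * Q) * (-1) := by
        have : ((m : ℤ) * (2 * Q - 2) + 1 - (2 * (m * Q - r) + 1)) = 2 * (r - m) := by ring
        rw [this, Int.mul_ediv_cancel_left _ two_ne_zero]; ring
      rw [this, Int.add_mul_emod_self_left]
      exact Int.emod_eq_of_lt (by nlinarith) (by nlinarith)
    · obtain rfl : r = 0 := by omega
      have hval : A 0 = 2 * (m * Q) := by rw [hS]; push_cast; simp; ring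
      rw [if_pos (by omega), hval, Int.mul_ediv_cancel_left _ two_ne_zero]
      push_cast; ring
  · have e1 : ∑ i ∈ Finset.range r, levelSeq m (2 * Q) 0 (m * (2 * Q * w + (q + 1)) + i) =
        ∑ i ∈ Finset.range r,
          ((if 2 * q + 4 ≤ 2 * Q then 2 * Q - 4 - 2 * q else 2 * q - 2 * Q + 4) +
          if (i : ℤ) ≤ 0 then (if 2 * q + 4 ≤ 2 * Q then 1 else 0) else 0) := by
      refine Finset.sum_congr rfl fun i hi => ?_
      rw [levelSeq_zero_apply hm' (by omega) hq1 w (by positivity)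
        (by have := Finset.mem_range.mp hi; omega)]
      split_ifs <;> omega
    rw [e1, sum_range_add_ite] at hS
    by_cases h4 : 2 * q + 4 ≤ 2 * Q
    · have hval : A 0 = 2 * (m * (Q - 1 - q) - r) + 1 := by
        have h2 : 2 * q + 2 ≤ 2 * Q := by omega
        rw [hS]
        simp only [h4, h2, if_true]
        split_ifs <;> ring
      have : ((m : ℤ) * (2 * Q - 2) + 1 - (2 * (m * (Q - 1 - q) - r) + 1)) / 2 = m * q + r := by
        have : ((m : ℤ) * (2 * Q - 2) + 1 - (2 * (m * (Q - 1 - q) - r) + 1)) =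
          2 * (m * q + r) := by ring
        rw [this, Int.mul_ediv_cancel_left _ two_ne_zero]
      rw [if_neg (by omega), hval, this]
      exact Int.emod_eq_of_lt (by positivity) (by nlinarith)
    · rw [if_neg h4, if_neg h4] at hS
      by_cases h2 : 2 * q + 2 ≤ 2 * Q
      · obtain rfl : q = Q - 1 := by omega
        rw [if_pos h2, if_pos h2] at hS
        by_cases hr' : 0 < r
        · have hval : A 0 = 2 * r := by
            rw [hS, if_pos hr', if_pos hr']; ring
          rw [if_pos (by omega), hval, Int.mul_ediv_cancel_left _ two_ne_zero]
        · obtain rfl : r = 0 := by omega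
          have hval : A 0 = 1 := by rw [hS, if_neg hr', if_neg hr']; push_cast; ring
          have : ((m : ℤ) * (2 * Q - 2) + 1 - 1) / 2 = m * (Q - 1) := by
            have : ((m : ℤ) * (2 * Q - 2) + 1 - 1) = 2 * (m * (Q - 1)) := by ring
            rw [this, Int.mul_ediv_cancel_left _ two_ne_zero]
          rw [if_neg (by omega), hval, this]
          push_cast
          rw [add_zero]
          exact Int.emod_eq_of_lt (by positivity) (by nlinarith)
      · rw [if_neg h2, if_neg h2] at hS
        have hval : A 0 = 2 * (m * (q - Q + 1) + r) := by
          rw [hS]; split_ifs <;> ring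
        rw [if_pos (by omega), hval, Int.mul_ediv_cancel_left _ two_ne_zero]
        ring

/-! ### Lifting the position from one level to the next -/

theorem levelSeq_succ_apply {m M s i : ℤ} (hm : 0 < m) (hM : 0 < M) (l : ℕ) {q' w : ℤ}
    (hw : levelPeriod m M l = m * w) (hq : 0 ≤ q') (hqw : q' < w)
    (hi : 0 ≤ i) (him : i < m) :
    levelSeq m M (l + 1) (m * (w * s + q') + i) =
      max 0 (min M (s % (m * M + 1) - M * (m - 1 - i))) := by
  have h1 : (m * (w * s + q') + i) % m = i := by
    rw [Int.mul_add_emod_self_left, Int.emod_eq_of_lt hi him]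
  have h2 : (m * (w * s + q') + i) / levelPeriod m M l = s := by
    have hN := levelPeriod_pos hm hM l
    have : m * (w * s + q') + i = (m * q' + i) + levelPeriod m M l * s := by rw [hw]; ring
    rw [this, Int.add_mul_ediv_left _ _ hN.ne',
      Int.ediv_eq_zero_of_lt (by positivity) (by rw [hw]; nlinarith), zero_add]
  simp only [levelSeq, h1, h2]

/-- Inside a stretch the window sees a rotated block, with sum s. In the last block of a stretch, at
offset r, put D = M(m - r): the old block contributes min(s, D), the new one the overflow of the
next counter value over D. The sum is s if s < D, it is D if s = mM (the next counter is 0), and s +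
1 otherwise. These outcomes lie below, at and above D, and r is known from the lower level. -/
theorem decodePosition_succ {m : ℕ} {M : ℤ} (hm : 0 < m) (hM : 0 < M) (t : ℤ)
    (A : ℕ → ℤ) (l : ℕ) (hA : A (l + 1) = ∑ c ∈ Finset.range m, levelSeq m M (l + 1) (t + c))
    (ih : decodePosition m M A l = t % levelPeriod m M l) :
    decodePosition m M A (l + 1) = t % levelPeriod m M (l + 1) := by
  have hm' : (0 : ℤ) < m := by exact_mod_cast hm
  have hN := levelPeriod_pos hm' hM l
  have hmM : 0 < m * M := by positivity
  obtain ⟨w, hw⟩ := dvd_levelPeriod m M l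
  have hw0 : 0 < w := by rw [hw] at hN; exact pos_of_mul_pos_right hN hm'.le
  obtain ⟨r, hrt⟩ := Int.eq_ofNat_of_zero_le (Int.emod_nonneg t hm'.ne')
  have hr : r < m := by have := Int.emod_lt_of_pos t hm'; omega
  have hrm : (r : ℤ) < m := by exact_mod_cast hr
  obtain ⟨q, hq⟩ : ∃ q, q = t / m % w := ⟨_, rfl⟩
  have hq0 : 0 ≤ q := hq ▸ Int.emod_nonneg _ hw0.ne'
  have hqw : q < w := hq ▸ Int.emod_lt_of_pos _ hw0
  have hT : t % levelPeriod m M l = m * q + r := by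
    rw [hw, Int.emod_mul_eq hm' hw0, hrt, hq]
  obtain ⟨s, hs⟩ : ∃ s, s = t / levelPeriod m M l := ⟨_, rfl⟩
  have ht : t = m * (w * s + q) + r := by
    have := Int.mul_ediv_add_emod t (levelPeriod m M l)
    rw [hT, ← hs] at this
    nth_rw 1 [hw] at this
    linear_combination (-1 : ℤ) * this
  have hs0 := Int.emod_nonneg s (by positivity : (m * M + 1 : ℤ) ≠ 0)
  have hs1 := Int.emod_lt_of_pos s (by positivity : (0 : ℤ) < m * M + 1)
  have hS : A (l + 1) =
      ∑ i ∈ Finset.range r, levelSeq m M (l + 1) (m * (w * s + (q + 1)) + i) +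
      ∑ i ∈ Finset.Ico r m, levelSeq m M (l + 1) (m * (w * s + q) + i) := by
    rw [hA, ht, sum_window_eq_add _ hr.le]
    simp only [add_assoc]
  have e2 : ∑ i ∈ Finset.Ico r m, levelSeq m M (l + 1) (m * (w * s + q) + i) =
      min (s % (m * M + 1)) (M * (m - r)) := by
    rw [← sum_clamp_Ico hs0 hM.le hr.le]
    refine Finset.sum_congr rfl fun i hi => ?_
    exact levelSeq_succ_apply hm' hM l hw hq0 hqw (by positivity)
      (by have := Finset.mem_Ico.mp hi; omega)
  rw [levelPeriod_succ, Int.emod_mul_eq hN (by positivity), ← hs, ← ih]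
  simp only [decodePosition]
  rw [ih, hT]
  congr 2
  rcases eq_or_lt_of_le (Int.add_one_le_iff.mpr hqw) with hq1 | hq1
  · have hs0' := Int.emod_nonneg (s + 1) (by positivity : (m * M + 1 : ℤ) ≠ 0)
    have hs1' := Int.emod_lt_of_pos (s + 1) (by positivity : (0 : ℤ) < m * M + 1)
    have e1 : ∑ i ∈ Finset.range r, levelSeq m M (l + 1) (m * (w * s + (q + 1)) + i) =
        (s + 1) % (m * M + 1) - min ((s + 1) % (m * M + 1)) (M * (m - r)) := by
      rw [← sum_clamp_range_reverse hs0' hM.le hr.le (by omega)]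
      refine Finset.sum_congr rfl fun i hi => ?_
      have : w * s + (q + 1) = w * (s + 1) + 0 := by rw [hq1]; ring
      rw [this]
      exact levelSeq_succ_apply hm' hM l hw le_rfl hw0 (by positivity)
        (by have := Finset.mem_range.mp hi; omega)
    rw [e1, e2] at hS
    have hρ : max 0 (m * q + r - (levelPeriod m M l - m)) = (r : ℤ) := by
      have : m * q + r - (levelPeriod m M l - m) = (r : ℤ) := by rw [hw, ← hq1]; ring
      rw [this]; simp
    rw [hρ]
    have hD : 0 ≤ M * (m - r) := mul_nonneg hM.le (by linarith)
    have hD' : M * (m - r) ≤ m * M := by nlinarith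
    have hs' : (s + 1) % (m * M + 1) =
        if s % (m * M + 1) = m * M then 0 else s % (m * M + 1) + 1 := by
      rw [← Int.emod_add_emod]
      split_ifs with h
      · rw [h, Int.emod_self]
      · exact Int.emod_eq_of_lt (by omega) (by omega)
    rw [hs'] at hS
    generalize M * ((m : ℤ) - r) = D at *
    generalize s % (m * M + 1) = s' at *
    generalize (m : ℤ) * M = B at *
    split_ifs at hS ⊢ <;> omega
  · have e1 : ∑ i ∈ Finset.range r, levelSeq m M (l + 1) (m * (w * s + (q + 1)) + i) =
        s % (m * M + 1) - min (s % (m * M + 1)) (M * (m - r)) := by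
      rw [← sum_clamp_range_reverse hs0 hM.le hr.le (by omega)]
      refine Finset.sum_congr rfl fun i hi => ?_
      exact levelSeq_succ_apply hm' hM l hw (by omega) hq1 (by positivity)
        (by have := Finset.mem_range.mp hi; omega)
    rw [e1, e2, sub_add_cancel] at hS
    -- Before the last block the truncation makes the threshold mM, so the equality branch returns
    -- the correct value s = mM.
    have hρ : max 0 (m * q + r - (levelPeriod m M l - m)) = 0 := by
      rw [max_eq_left]
      rw [hw]
      nlinarith
    rw [hρ, sub_zero, mul_comm M, hS]
    generalize s % (m * M + 1) = s' at *
    generalize (m : ℤ) * M = B at *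
    split_ifs <;> omega

theorem decodePosition_eq {m : ℕ} {M : ℤ} (hm : 0 < m) (hM : 0 < M) (hM2 : 2 ∣ M) (t : ℤ)
    (A : ℕ → ℤ) (l : ℕ)
    (hA : ∀ i ≤ l, A i = ∑ c ∈ Finset.range m, levelSeq m M i (t + c)) :
    decodePosition m M A l = t % levelPeriod m M l := by
  induction l with
  | zero =>
    rw [decodePosition_zero hm hM hM2 t A (hA 0 le_rfl)]
    simp [levelPeriod]
  | succ l ih =>
    exact decodePosition_succ hm hM t A l (hA _ le_rfl) (ih fun i hi => hA i (by omega))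

/-! ### Counting cells of one colour in a window -/

/-- Among the cells of a slice, identified with their digit vectors, the residue class `s` of
digit sums meets every group of `K` consecutive codes exactly once. -/
theorem card_digits_code_div_lt {e m K g : ℕ} (hK : 0 < K) (hm : m = K * g) (t s : ℤ)
    (hs0 : 0 ≤ s) (hsK : s < K) (a : ℕ) (ha : a ≤ g * m ^ e) :
    (Finset.univ.filter fun z : Fin (e + 1) → Fin m =>
      (t + ∑ i, ((z i : ℕ) : ℤ)) % K = s ∧ (∑ i, (z i : ℕ) * m ^ (i : ℕ)) / K < a).card = a := by
  -- Since K divides m, only the lowest digit is affected by the division: its quotient becomes a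
  -- base-g digit below the code of the other digits.
  have code (z : Fin (e + 1) → Fin m) : (∑ i, (z i : ℕ) * m ^ (i : ℕ)) / K =
      (z 0 : ℕ) / K + g * (finFunctionFinEquiv fun i : Fin e => z i.succ : Fin (m ^ e)) := by
    rw [finFunctionFinEquiv_apply, Fin.sum_univ_succ]
    have : ∑ i : Fin e, (z i.succ : ℕ) * m ^ (i.succ : ℕ) =
        K * (g * ∑ i : Fin e, (z i.succ : ℕ) * m ^ (i : ℕ)) := by
      rw [← mul_assoc, ← hm, Finset.mul_sum]
      refine Finset.sum_congr rfl fun i _ => ?_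
      rw [Fin.val_succ]; ring
    rw [this, Nat.add_mul_div_left _ _ hK]
    simp
  have div_lt (w : Fin m) : (w : ℕ) / K < g :=
    Nat.div_lt_of_lt_mul (hm ▸ w.2)
  conv_rhs => rw [← Finset.card_range a]
  refine Finset.card_nbij (fun z => (∑ i, (z i : ℕ) * m ^ (i : ℕ)) / K) (fun z hz => ?_)
    (fun z hz z' hz' h => ?_) (fun q hq => ?_)
  · simpa using (Finset.mem_filter.mp hz).2.2
  · have h1 := (Finset.mem_filter.mp hz).2.1
    have h2 := (Finset.mem_filter.mp hz').2.1
    simp only [code] at h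
    have hg : 0 < g := (Nat.zero_le _).trans_lt (div_lt (z 0))
    have hmod := congrArg (· % g) h
    have hdiv := congrArg (· / g) h
    simp only [Nat.add_mul_mod_self_left, Nat.mod_eq_of_lt (div_lt _)] at hmod
    simp only [Nat.add_mul_div_left _ _ hg, Nat.div_eq_of_lt (div_lt _), zero_add] at hdiv
    have htail := finFunctionFinEquiv.injective (Fin.ext hdiv)
    have hsum : ∑ i : Fin e, ((z i.succ : ℕ) : ℤ) = ∑ i : Fin e, ((z' i.succ : ℕ) : ℤ) :=
      Finset.sum_congr rfl fun i _ => by rw [congrFun htail i]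
    rw [Fin.sum_univ_succ] at h1 h2
    rw [← h2, hsum] at h1
    -- The code quotient fixes the other digits and z 0 / K; the digit sum supplies z 0 modulo K.
    have h3 : ((z 0 : ℕ) : ℤ) % K = ((z' 0 : ℕ) : ℤ) % K := by
      have h4 : ((z 0 : ℕ) : ℤ) ≡ ((z' 0 : ℕ) : ℤ) [ZMOD K] :=
        Int.ModEq.add_right_cancel' _ (Int.ModEq.add_left_cancel' t h1)
      exact h4
    have h5 : (z 0 : ℕ) % K = (z' 0 : ℕ) % K := by exact_mod_cast h3
    have h0 : z 0 = z' 0 := Fin.ext (by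
      rw [← Nat.div_add_mod (z 0 : ℕ) K, ← Nat.div_add_mod (z' 0 : ℕ) K, hmod, h5])
    funext i
    refine Fin.cases h0 (fun i => congrFun htail i) i
  · have hqa : q < a := by simpa using hq
    have hg : 0 < g := by
      rcases Nat.eq_zero_or_pos g with rfl | h
      · simp at ha; omega
      · exact h
    have hq1 : q / g < m ^ e := Nat.div_lt_of_lt_mul (hqa.trans_le ha)
    obtain ⟨y, hy⟩ : ∃ y : Fin e → Fin m, (finFunctionFinEquiv y : Fin (m ^ e)) = ⟨q / g, hq1⟩ :=
      ⟨_, finFunctionFinEquiv.apply_symm_apply _⟩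
    have hKz : (K : ℤ) ≠ 0 := by exact_mod_cast hK.ne'
    -- r is the residue of the lowest digit that brings the digit sum into class s.
    obtain ⟨r, hr⟩ := Int.eq_ofNat_of_zero_le
      (Int.emod_nonneg (s - t - ∑ i, ((y i : ℕ) : ℤ)) hKz)
    have hrK : r < K := by
      have := Int.emod_lt_of_pos (s - t - ∑ i, ((y i : ℕ) : ℤ)) (b := K) (by exact_mod_cast hK)
      omega
    have hlt : K * (q % g) + r < m := by
      have := Nat.mod_lt q hg
      rw [hm]; nlinarith
    refine ⟨Fin.cons ⟨K * (q % g) + r, hlt⟩ y, ?_, ?_⟩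
    · have hc := code (Fin.cons ⟨K * (q % g) + r, hlt⟩ y)
      simp only [Fin.cons_zero, Fin.cons_succ] at hc
      rw [hy, Nat.mul_add_div hK, Nat.div_eq_of_lt hrK, add_zero, Nat.mod_add_div] at hc
      rw [Finset.mem_coe, Finset.mem_filter, hc]
      refine ⟨Finset.mem_univ _, ?_, hqa⟩
      rw [Fin.sum_univ_succ]
      simp only [Fin.cons_zero, Fin.cons_succ]
      push_cast
      have e1 : t + ((K : ℤ) * ((q : ℤ) % g) + r + ∑ i, ((y i : ℕ) : ℤ)) =
          (r + (t + ∑ i, ((y i : ℕ) : ℤ))) + K * ((q : ℤ) % g) := by ring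
      rw [e1, Int.add_mul_emod_self_left]
      change _ = ((r : ℕ) : ℤ) at hr
      rw [← hr, Int.emod_add_emod]
      have e2 : s - t - ∑ i, ((y i : ℕ) : ℤ) + (t + ∑ i, ((y i : ℕ) : ℤ)) = s := by ring
      rw [e2, Int.emod_eq_of_lt hs0 hsK]
    · have hc := code (Fin.cons ⟨K * (q % g) + r, hlt⟩ y)
      simp only [Fin.cons_zero, Fin.cons_succ] at hc
      rw [hy, Nat.mul_add_div hK, Nat.div_eq_of_lt hrK, add_zero, Nat.mod_add_div] at hc
      exact hc

/-- Translation by `y` modulo `m`, as a permutation of the residues. -/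
noncomputable def shiftResidue (m : ℕ) (hm : 0 < m) (y : ℤ) : Fin m ≃ Fin m :=
  Equiv.ofBijective
    (fun c => ⟨((y + (c : ℕ)) % m).toNat, by
      have := Int.emod_nonneg (y + (c : ℕ)) (b := m) (by omega)
      have := Int.emod_lt_of_pos (y + (c : ℕ)) (b := m) (by omega)
      omega⟩)
    (Finite.injective_iff_bijective.mp fun c c' h => by
      have h1 := Int.emod_nonneg (y + (c : ℕ)) (b := m) (by omega)
      have h2 := Int.emod_nonneg (y + (c' : ℕ)) (b := m) (by omega)
      have h3 := congrArg Fin.val h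
      simp only at h3
      have h4 : y + (c : ℕ) ≡ y + (c' : ℕ) [ZMOD m] := by
        unfold Int.ModEq; omega
      have h5 : (c : ℕ) ≡ (c' : ℕ) [MOD m] :=
        Int.natCast_modEq_iff.mp (Int.ModEq.add_left_cancel' y h4)
      exact Fin.ext (Nat.ModEq.eq_of_lt_of_lt h5 c.2 c'.2))

theorem shiftResidue_coe (m : ℕ) (hm : 0 < m) (y : ℤ) (c : Fin m) :
    (((shiftResidue m hm y c : Fin m) : ℕ) : ℤ) = (y + (c : ℕ)) % m := by
  simp only [shiftResidue, Equiv.ofBijective_apply]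
  exact Int.toNat_of_nonneg (Int.emod_nonneg _ (by omega))

/-- In each coordinate a window meets every residue modulo m once, so reduction modulo m maps it
bijectively to the digit vectors; as K divides m, the sum modulo K is preserved. -/
theorem card_window_code_div_lt {e m K g : ℕ} (hK : 0 < K) (hm0 : 0 < m) (hm : m = K * g)
    (t s : ℤ) (y : Fin (e + 1) → ℤ) (hs0 : 0 ≤ s) (hsK : s < K) (a : ℤ) (ha0 : 0 ≤ a)
    (ha : a ≤ g * m ^ e) :
    ((Finset.univ.filter fun c : Fin (e + 1) → Fin m =>
      (t + ∑ i, (y i + (c i : ℕ))) % K = s ∧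
        (∑ i, (y i + (c i : ℕ)) % m * (m : ℤ) ^ (i : ℕ)) / K < a).card : ℤ) = a := by
  obtain ⟨a, rfl⟩ := Int.eq_ofNat_of_zero_le ha0
  have hcard := card_digits_code_div_lt (e := e) hK hm t s hs0 hsK a (by exact_mod_cast ha)
  conv_rhs => rw [← hcard]
  rw [Int.natCast_inj]
  refine Finset.card_equiv (Equiv.piCongrRight fun i => shiftResidue m hm0 (y i)) fun c => ?_
  simp only [Finset.mem_filter, Finset.mem_univ, true_and, Equiv.piCongrRight_apply, Pi.map_apply]
  rw [← Int.ofNat_lt]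
  push_cast
  simp only [shiftResidue_coe]
  have : (t + ∑ i, (y i + (c i : ℕ))) % (K : ℤ) = (t + ∑ i, (y i + (c i : ℕ)) % (m : ℤ)) % K := by
    refine Int.ModEq.add_left t ?_
    refine Int.ModEq.sum fun i _ => ?_
    exact ((Int.mod_modEq _ (m : ℤ)).symm).of_dvd ⟨g, by rw [hm]; push_cast; ring⟩
  rw [this]

/-! ### The colouring -/

/-- The colour that carries the sequence number `l` in direction `j`. -/
def colourIndex {d b : ℕ} (p : Fin d × Fin b) : ℕ := b * p.1 + p.2

theorem colourIndex_lt {d b : ℕ} (p : Fin d × Fin b) : colourIndex p < b * d := by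
  have h1 := p.1.2
  have h2 := p.2.2
  unfold colourIndex
  nlinarith

theorem colourIndex_injective {d b : ℕ} :
    Function.Injective (colourIndex : Fin d × Fin b → ℕ) := by
  rintro ⟨j, l⟩ ⟨j', l'⟩ h
  simp only [colourIndex] at h
  have hb : 0 < b := (Nat.zero_le _).trans_lt l.2
  have h1 := congrArg (· / b) h
  have h2 := congrArg (· % b) h
  simp only [Nat.mul_add_div hb, Nat.div_eq_of_lt l.2, Nat.div_eq_of_lt l'.2, Nat.mul_add_mod,
    Nat.mod_eq_of_lt l.2, Nat.mod_eq_of_lt l'.2, add_zero] at h1 h2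
  exact Prod.ext (Fin.ext h1) (Fin.ext h2)

theorem exists_colourIndex_eq {d b s : ℕ} (hs : s < b * d) :
    ∃ p : Fin d × Fin b, colourIndex p = s := by
  have hb : 0 < b := Nat.pos_of_mul_pos_right ((Nat.zero_le _).trans_lt hs)
  exact ⟨(⟨s / b, Nat.div_lt_of_lt_mul hs⟩, ⟨s % b, Nat.mod_lt _ hb⟩), Nat.div_add_mod _ _⟩

/-- The number whose base-`m` digits are the coordinates of `x` modulo `m`, except coordinate
`j`. -/
def sliceCode {e : ℕ} (m : ℤ) (j : Fin (e + 1)) (x : Fin (e + 1) → ℤ) : ℤ :=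
  ∑ i : Fin e, x (j.succAbove i) % m * m ^ (i : ℕ)

/-- The number of cells in a slice of the window, divided by the number `K` of colours that are
not the filler colour. -/
def sliceCapacity (e : ℕ) (K m : ℤ) : ℤ := m ^ e / K

/-- The cell `x` is reserved for the colour `∑ i, x i` modulo `K = b * (e + 1)`; it receives
either this colour or the filler colour `K`. -/
def colourValue {e : ℕ} (b : ℕ) (m : ℤ) (x : Fin (e + 1) → ℤ) : ℤ :=
  b * (e + 1) + ∑ p : Fin (e + 1) × Fin b,
    if (∑ i, x i) % (b * (e + 1)) = colourIndex p then
      if sliceCode m p.1 x / (b * (e + 1)) <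
          levelSeq m (sliceCapacity e (b * (e + 1)) m) p.2 (x p.1) then
        (colourIndex p : ℤ) - b * (e + 1)
      else 0
    else 0

/-- The grid colouring for window size `m`. -/
def gridColouring (e b : ℕ) (m : ℤ) (x : Fin (e + 1) → ℤ) : Fin (b * (e + 1) + 1) :=
  Fin.ofNat (b * (e + 1) + 1) (colourValue b m x).toNat

/-- Distinct pairs have distinct indices, so only one summand survives. Summing over all pairs,
rather than selecting one, makes the colour visibly an arithmetic term. -/
theorem colourValue_eq {e b : ℕ} (m : ℤ) (x : Fin (e + 1) → ℤ) {p : Fin (e + 1) × Fin b}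
    (hp : (∑ i, x i) % (b * (e + 1)) = colourIndex p) :
    colourValue b m x = if sliceCode m p.1 x / (b * (e + 1)) <
          levelSeq m (sliceCapacity e (b * (e + 1)) m) p.2 (x p.1) then
        (colourIndex p : ℤ) else b * (e + 1) := by
  unfold colourValue
  rw [Finset.sum_eq_single p (fun p' _ hne => if_neg fun h => hne (colourIndex_injective
    (by exact_mod_cast h.symm.trans hp))) (fun h => (h (Finset.mem_univ _)).elim), if_pos hp]
  split_ifs <;> ring

theorem exists_reserved {e b : ℕ} (hb : 0 < b) (x : Fin (e + 1) → ℤ) :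
    ∃ p : Fin (e + 1) × Fin b, (∑ i, x i) % (b * (e + 1)) = colourIndex p := by
  have hK : (0 : ℤ) < b * (e + 1) := by positivity
  obtain ⟨s, hs⟩ := Int.eq_ofNat_of_zero_le (Int.emod_nonneg (∑ i, x i) hK.ne')
  have := Int.emod_lt_of_pos (∑ i, x i) hK
  obtain ⟨p, hp⟩ := exists_colourIndex_eq (d := e + 1) (b := b) (s := s) (by
    rw [hs] at this; exact_mod_cast this)
  exact ⟨p, by rw [hs, hp]⟩

theorem gridColouring_val {e b : ℕ} (hb : 0 < b) (m : ℤ) (x : Fin (e + 1) → ℤ) :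
    ((gridColouring e b m x : ℕ) : ℤ) = colourValue b m x := by
  obtain ⟨p, hp⟩ := exists_reserved hb x
  have hlt := colourIndex_lt p
  have hv : 0 ≤ colourValue b m x ∧ colourValue b m x ≤ (b * (e + 1) : ℕ) := by
    rw [colourValue_eq m x hp]
    split_ifs
    · exact ⟨by positivity, by exact_mod_cast hlt.le⟩
    · exact ⟨by positivity, by push_cast; exact le_rfl⟩
  simp only [gridColouring, Fin.ofNat]
  rw [Nat.mod_eq_of_lt (by omega), Int.toNat_of_nonneg hv.1]

theorem gridColouring_eq_iff {e b : ℕ} (hb : 0 < b) (m : ℤ) (x : Fin (e + 1) → ℤ)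
    (p : Fin (e + 1) × Fin b) :
    (gridColouring e b m x : ℕ) = colourIndex p ↔
      (∑ i, x i) % (b * (e + 1)) = colourIndex p ∧ sliceCode m p.1 x / (b * (e + 1)) <
          levelSeq m (sliceCapacity e (b * (e + 1)) m) p.2 (x p.1) := by
  obtain ⟨p', hp'⟩ := exists_reserved hb x
  rw [← Int.natCast_inj, gridColouring_val hb, colourValue_eq m x hp']
  have hlt : (colourIndex p : ℤ) < b * (e + 1) := by exact_mod_cast colourIndex_lt p
  by_cases h : p' = p
  · subst h
    split_ifs with h1
    · simp [hp', h1]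
    · simp only [h1, and_false, iff_false]; omega
  · have h' : colourIndex p' ≠ colourIndex p := fun h' => h (colourIndex_injective h')
    split_ifs with h1 <;> omega

theorem sliceCapacity_eq {e b m g : ℕ} (hm : 0 < m) (hg : m = b * (e + 1 + 1) * g) :
    sliceCapacity (e + 1) (b * ((e + 1 : ℕ) + 1)) m = g * m ^ e := by
  have hK : (b * ((e + 1 : ℕ) + 1) : ℤ) ≠ 0 := by
    intro h
    have h' : b * (e + 1 + 1) = 0 := by exact_mod_cast h
    rw [h', zero_mul] at hg
    omega
  have : (m : ℤ) ^ (e + 1) = b * ((e + 1 : ℕ) + 1) * (g * m ^ e) := by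
    rw [pow_succ, ← mul_assoc, mul_comm]
    congr 1
    exact_mod_cast hg
  rw [sliceCapacity, this, Int.mul_ediv_cancel_left _ hK]

theorem count_gridColouring {e b m g : ℕ} (hb : 0 < b) (hm : 0 < m)
    (hg : m = b * (e + 1 + 1) * g) (x : Fin (e + 1 + 1) → ℤ) (p : Fin (e + 1 + 1) × Fin b)
    (c : Fin (b * (e + 1 + 1) + 1)) (hc : (c : ℕ) = colourIndex p)
    (hpos : 0 < sliceCapacity (e + 1) (b * ((e + 1 : ℕ) + 1)) m) :
    (((entryMultiset (windowPattern (gridColouring (e + 1) b m) m x)).count c : ℕ) : ℤ) =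
      ∑ i ∈ Finset.range m,
        levelSeq m (sliceCapacity (e + 1) (b * ((e + 1 : ℕ) + 1)) m) p.2 (x p.1 + i) := by
  have hm' : (0 : ℤ) < m := by exact_mod_cast hm
  have hK : (b * (e + 1 + 1) : ℕ) = (b * ((e + 1 : ℕ) + 1) : ℤ) := by push_cast; ring
  have h1 : (entryMultiset (windowPattern (gridColouring (e + 1) b m) m x)).count c =
      (Finset.univ.filter fun a : Fin (e + 1 + 1) → Fin m =>
        c = windowPattern (gridColouring (e + 1) b m) m x a).card := by
    rw [entryMultiset, Multiset.count_map]
    rfl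
  -- Cut the window into slices orthogonal to the direction of the colour and count in each slice.
  rw [h1, Finset.card_filter, ← Equiv.sum_comp (Fin.insertNthEquiv (fun _ => Fin m) p.1),
    Fintype.sum_prod_type, Finset.sum_range]
  push_cast only [Nat.cast_sum]
  refine Finset.sum_congr rfl fun i _ => ?_
  rw [← Nat.cast_sum, ← Finset.card_filter]
  rw [← card_window_code_div_lt (K := b * (e + 1 + 1)) (e := e) (by positivity) hm hg
    (x p.1 + (i : ℕ)) (colourIndex p) (fun a => x (p.1.succAbove a)) (by positivity)
    (by exact_mod_cast colourIndex_lt p) (levelSeq m _ p.2 (x p.1 + (i : ℕ)))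
    (levelSeq_nonneg hm' hpos _ _)
    ((levelSeq_le hm' hpos _ _).trans_eq (sliceCapacity_eq hm hg))]
  congr 2
  ext a
  rw [Finset.mem_filter, Finset.mem_filter, hK]
  refine and_congr_right fun _ => ?_
  rw [Fin.ext_iff, hc, eq_comm, windowPattern, gridColouring_eq_iff hb, Fin.sum_univ_succAbove _ p.1]
  simp [sliceCode]

/-! ### Straight-line arithmetic terms and their compilation to programs -/

/-- Loop-free arithmetic terms with conditionals, in `p` variables. -/
inductive ArithTerm (p : ℕ) where
  | var (i : Fin p)
  | const (z : ℤ)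
  | op (o : ArithOp) (e f : ArithTerm p)
  | ite (a b e f : ArithTerm p)

namespace ArithTerm

variable {p : ℕ}

/-- The value of a term. -/
def eval (v : Fin p → ℤ) : ArithTerm p → ℤ
  | var i => v i
  | const z => z
  | op o e f => o.eval (e.eval v) (f.eval v)
  | ite a b e f => if a.eval v ≤ b.eval v then e.eval v else f.eval v

/-- A bound for the number of operations of the compiled term. -/
def cost : ArithTerm p → ℕ
  | var _ => 1
  | const _ => 1
  | op _ e f => e.cost + (f.cost + 1)
  | ite a b e f => a.cost + (b.cost + (e.cost + f.cost + 1))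

/-- A program that stores the value of the term in register `r` and changes no register below
`r`. -/
def compile : ArithTerm p → ℕ → Prog
  | var i, r => .copy r i
  | const z, r => .const r z
  | op o e f, r => .seq (e.compile r) (.seq (f.compile (r + 1)) (.arith o r r (r + 1)))
  | ite a b e f, r =>
    .seq (a.compile r) (.seq (b.compile (r + 1)) (.ite r (r + 1) (e.compile r) (f.compile r)))

/-- Preserving the registers below r keeps the inputs intact and lets the first operand, in r,
survive the evaluation of the second in r + 1. -/
theorem runs_compile (v : Fin p → ℤ) (e : ArithTerm p) :
    ∀ (r : ℕ) (σ : ℕ → ℤ), p ≤ r → (∀ i : Fin p, σ i = v i) →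
      ∃ τ t, (e.compile r).Runs σ τ t ∧ t ≤ e.cost ∧ τ r = e.eval v ∧ ∀ i < r, τ i = σ i := by
  induction e with
  | var i =>
    intro r σ hr hσ
    refine ⟨_, _, .copy σ r i, le_rfl, ?_, fun j hj => Function.update_of_ne hj.ne _ _⟩
    rw [Function.update_self]
    exact hσ i
  | const z =>
    intro r σ hr hσ
    exact ⟨_, _, .const σ r z, le_rfl, Function.update_self .., fun j hj =>
      Function.update_of_ne hj.ne _ _⟩
  | op o e f he hf =>
    intro r σ hr hσ
    obtain ⟨τ, t, h1, h2, h3, h4⟩ := he r σ hr hσ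
    obtain ⟨υ, u, g1, g2, g3, g4⟩ := hf (r + 1) τ (by omega)
      fun i => (h4 i (by omega)).trans (hσ i)
    refine ⟨_, _, .seq h1 (.seq g1 (.arith υ o r r (r + 1))), ?_, ?_, fun j hj => ?_⟩
    · simp only [cost]; omega
    · rw [Function.update_self, g3, g4 r (by omega), h3, eval]
    · rw [Function.update_of_ne hj.ne, g4 j (by omega), h4 j hj]
  | ite a b e f ha hb he hf =>
    intro r σ hr hσ
    obtain ⟨τ, t, h1, h2, h3, h4⟩ := ha r σ hr hσ
    obtain ⟨υ, u, g1, g2, g3, g4⟩ := hb (r + 1) τ (by omega)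
      fun i => (h4 i (by omega)).trans (hσ i)
    have hυ : ∀ j < r, υ j = σ j := fun j hj => (g4 j (by omega)).trans (h4 j hj)
    have hυ' : ∀ i : Fin p, υ i = v i := fun i => (hυ i (by omega)).trans (hσ i)
    by_cases h : a.eval v ≤ b.eval v
    · obtain ⟨φ, s, k1, k2, k3, k4⟩ := he r υ hr hυ'
      refine ⟨_, _, .seq h1 (.seq g1 (.ite_true ?_ k1)), ?_, ?_, fun j hj => ?_⟩
      · rwa [g3, g4 r (by omega), h3]
      · simp only [cost]; omega
      · rw [k3, eval, if_pos h]
      · rw [k4 j hj, hυ j hj]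
    · obtain ⟨φ, s, k1, k2, k3, k4⟩ := hf r υ hr hυ'
      refine ⟨_, _, .seq h1 (.seq g1 (.ite_false ?_ k1)), ?_, ?_, fun j hj => ?_⟩
      · rwa [g3, g4 r (by omega), h3]
      · simp only [cost]; omega
      · rw [k3, eval, if_neg h]
      · rw [k4 j hj, hυ j hj]

/-- The values of finitely many terms can be stored in consecutive registers. -/
theorem exists_prog_eval (q B : ℕ) (hB : p ≤ B) (e : Fin q → ArithTerm p) :
    ∃ (P : Prog) (K : ℕ), ∀ (v : Fin p → ℤ) (σ : ℕ → ℤ), (∀ i : Fin p, σ i = v i) →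
      ∃ τ t, P.Runs σ τ t ∧ t ≤ K ∧ (∀ i : Fin q, τ (B + i) = (e i).eval v) ∧
        ∀ i < B, τ i = σ i := by
  induction q with
  | zero => exact ⟨.skip, 0, fun v σ _ => ⟨σ, 0, .skip σ, le_rfl, fun i => i.elim0, fun _ _ => rfl⟩⟩
  | succ q ih =>
    obtain ⟨P, K, hP⟩ := ih fun i => e i.castSucc
    refine ⟨.seq P ((e (Fin.last q)).compile (B + q)), K + (e (Fin.last q)).cost,
      fun v σ hσ => ?_⟩
    obtain ⟨τ, t, h1, h2, h3, h4⟩ := hP v σ hσ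
    obtain ⟨υ, u, g1, g2, g3, g4⟩ := runs_compile v (e (Fin.last q)) (B + q) τ (by omega)
      fun i => (h4 i (by omega)).trans (hσ i)
    refine ⟨υ, _, .seq h1 g1, by omega, fun i => ?_, fun i hi => ?_⟩
    · induction i using Fin.lastCases with
      | last => simpa using g3
      | cast i => rw [← h3 i]; exact g4 _ (by simp)
    · rw [g4 i (by omega), h4 i hi]

/-- A block of registers can be copied to the first registers. -/
theorem exists_prog_copy (q B : ℕ) (hB : q ≤ B) :
    ∃ (P : Prog) (K : ℕ), ∀ σ : ℕ → ℤ, ∃ τ t, P.Runs σ τ t ∧ t ≤ K ∧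
      (∀ i < q, τ i = σ (B + i)) ∧ ∀ i, q ≤ i → τ i = σ i := by
  induction q with
  | zero => exact ⟨.skip, 0, fun σ => ⟨σ, 0, .skip σ, le_rfl, fun i hi => by omega, fun _ _ => rfl⟩⟩
  | succ q ih =>
    obtain ⟨P, K, hP⟩ := ih (by omega)
    refine ⟨.seq P (.copy q (B + q)), K + 1, fun σ => ?_⟩
    obtain ⟨τ, t, h1, h2, h3, h4⟩ := hP σ
    refine ⟨_, _, .seq h1 (.copy τ q (B + q)), by omega, fun i hi => ?_, fun i hi => ?_⟩
    · rcases Nat.lt_succ_iff_lt_or_eq.mp hi with hi | rfl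
      · rw [Function.update_of_ne hi.ne, h3 i hi]
      · rw [Function.update_self, h4 _ (by omega)]
    · rw [Function.update_of_ne (by omega), h4 i (by omega)]

end ArithTerm

/-- Functions given by a loop-free arithmetic term. -/
def IsArith {p : ℕ} (F : (Fin p → ℤ) → ℤ) : Prop :=
  ∃ e : ArithTerm p, ∀ v, e.eval v = F v

theorem exists_prog_of_isArith {p q : ℕ} {F : (Fin p → ℤ) → Fin q → ℤ}
    (hF : ∀ i, IsArith fun v => F v i) :
    ∃ (P : Prog) (K : ℕ), ∀ v, P.ComputesWithin K v (F v) := by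
  choose e he using hF
  -- Results start at register p + q: above the inputs, which later terms still read, and clear of
  -- the q output registers.
  obtain ⟨P, K, hP⟩ := ArithTerm.exists_prog_eval q (p + q) (Nat.le_add_right p q) e
  obtain ⟨P', K', hP'⟩ := ArithTerm.exists_prog_copy q (p + q) (Nat.le_add_left q p)
  refine ⟨.seq P P', K + K', fun v => ?_⟩
  obtain ⟨τ, t, h1, h2, h3, -⟩ := hP v (loadInput v) fun i => by simp [loadInput]
  obtain ⟨υ, u, g1, g2, g3, -⟩ := hP' τ
  exact ⟨υ, _, .seq h1 g1, by omega, fun i => by rw [g3 i i.2, h3, he]⟩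

theorem Prog.ComputesWithin.mono {p q : ℕ} {P : Prog} {K K' : ℕ} {v : Fin p → ℤ} {w : Fin q → ℤ}
    (h : P.ComputesWithin K v w) (hK : K ≤ K') : P.ComputesWithin K' v w := by
  obtain ⟨τ, t, h1, h2, h3⟩ := h
  exact ⟨τ, t, h1, h2.trans hK, h3⟩

namespace IsArith

variable {p : ℕ} {F G H I : (Fin p → ℤ) → ℤ}

theorem var (i : Fin p) : IsArith fun v : Fin p → ℤ => v i := ⟨.var i, fun _ => rfl⟩

theorem const (z : ℤ) : IsArith fun _ : Fin p → ℤ => z := ⟨.const z, fun _ => rfl⟩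

theorem op (o : ArithOp) (hF : IsArith F) (hG : IsArith G) :
    IsArith fun v => o.eval (F v) (G v) := by
  obtain ⟨e, he⟩ := hF
  obtain ⟨f, hf⟩ := hG
  exact ⟨.op o e f, fun v => by rw [ArithTerm.eval, he, hf]⟩

theorem add (hF : IsArith F) (hG : IsArith G) : IsArith fun v => F v + G v := op .add hF hG

theorem sub (hF : IsArith F) (hG : IsArith G) : IsArith fun v => F v - G v := op .sub hF hG

theorem mul (hF : IsArith F) (hG : IsArith G) : IsArith fun v => F v * G v := op .mul hF hG

theorem ediv (hF : IsArith F) (hG : IsArith G) : IsArith fun v => F v / G v := op .quo hF hG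

theorem emod (hF : IsArith F) (hG : IsArith G) : IsArith fun v => F v % G v := op .rem hF hG

theorem ite_le (hF : IsArith F) (hG : IsArith G) (hH : IsArith H) (hI : IsArith I) :
    IsArith fun v => if F v ≤ G v then H v else I v := by
  obtain ⟨e, he⟩ := hF
  obtain ⟨f, hf⟩ := hG
  obtain ⟨g, hg⟩ := hH
  obtain ⟨h, hh⟩ := hI
  exact ⟨.ite e f g h, fun v => by rw [ArithTerm.eval, he, hf, hg, hh]⟩

theorem max (hF : IsArith F) (hG : IsArith G) : IsArith fun v => max (F v) (G v) := by
  simpa only [max_def] using ite_le hF hG hG hF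

theorem min (hF : IsArith F) (hG : IsArith G) : IsArith fun v => min (F v) (G v) := by
  simpa only [min_def] using ite_le hF hG hF hG

theorem ite_lt (hF : IsArith F) (hG : IsArith G) (hH : IsArith H) (hI : IsArith I) :
    IsArith fun v => if F v < G v then H v else I v := by
  simpa only [Int.lt_iff_add_one_le] using ite_le (hF.add (const 1)) hG hH hI

theorem ite_eq (hF : IsArith F) (hG : IsArith G) (hH : IsArith H) (hI : IsArith I) :
    IsArith fun v => if F v = G v then H v else I v := by
  simpa only [le_antisymm_iff, ite_and] using ite_le hF hG (ite_le hG hF hH hI) hI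

theorem pow (hF : IsArith F) (n : ℕ) : IsArith fun v => F v ^ n := by
  induction n with
  | zero => simpa using const 1
  | succ n ih => simpa only [pow_succ] using ih.mul hF

theorem sum {ι : Type*} (s : Finset ι) {F : ι → (Fin p → ℤ) → ℤ} (hF : ∀ i, IsArith (F i)) :
    IsArith fun v => ∑ i ∈ s, F i v := by
  classical
  induction s using Finset.induction_on with
  | empty => simpa using const 0
  | insert i s hi ih => simpa only [Finset.sum_insert hi] using (hF i).add ih

end IsArith

/-! ### The construction is given by arithmetic terms -/

namespace IsArith

variable {p : ℕ} {F G H : (Fin p → ℤ) → ℤ}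

theorem levelPeriod (hF : IsArith F) (hG : IsArith G) (l : ℕ) :
    IsArith fun v => levelPeriod (F v) (G v) l :=
  (hF.mul hG).mul (((hF.mul hG).add (const 1)).pow l)

theorem levelSeq (hF : IsArith F) (hG : IsArith G) (hH : IsArith H) (l : ℕ) :
    IsArith fun v => levelSeq (F v) (G v) l (H v) := by
  cases l with
  | zero =>
    have hq : IsArith fun v => 2 * (H v % (F v * G v) / F v) :=
      (const 2).mul ((hH.emod (hF.mul hG)).ediv hF)
    exact ite_le (hq.add (const 2)) hG
      (((hG.sub (const 2)).sub hq).add (ite_le (hH.emod hF) (const 0) (const 1) (const 0)))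
      ((hq.sub hG).add (const 2))
  | succ l =>
    exact (const 0).max (hG.min
      (((hH.ediv (hF.levelPeriod hG l)).emod ((hF.mul hG).add (const 1))).sub
        (hG.mul ((hF.sub (const 1)).sub (hH.emod hF)))))

theorem decodePosition (hF : IsArith F) (hG : IsArith G) {A : (Fin p → ℤ) → ℕ → ℤ}
    (hA : ∀ l, IsArith fun v => A v l) (l : ℕ) :
    IsArith fun v => decodePosition (F v) (G v) (A v) l := by
  induction l with
  | zero =>
    exact ite_le ((hA 0).emod (const 2)) (const 0)
      ((hF.mul ((hG.ediv (const 2)).sub (const 1))).add ((hA 0).ediv (const 2)))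
      (((((hF.mul (hG.sub (const 2))).add (const 1)).sub (hA 0)).ediv (const 2)).emod (hF.mul hG))
  | succ l ih =>
    have hN := hF.levelPeriod hG l
    have hD := hG.mul (hF.sub ((const 0).max (ih.sub (hN.sub hF))))
    exact (hN.mul (ite_le ((hA (l + 1)).add (const 1)) hD (hA (l + 1))
      (ite_le (hA (l + 1)) hD (hF.mul hG) ((hA (l + 1)).sub (const 1))))).add ih

theorem sliceCapacity (hF : IsArith F) (e : ℕ) (K : ℤ) :
    IsArith fun v => sliceCapacity e K (F v) :=
  (hF.pow e).ediv (const K)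

theorem colourValue {e : ℕ} (b : ℕ) (hF : IsArith F) {x : (Fin p → ℤ) → Fin (e + 1) → ℤ}
    (hx : ∀ i, IsArith fun v => x v i) : IsArith fun v => colourValue b (F v) (x v) := by
  refine (const _).add (sum _ fun q => ite_eq ((sum _ hx).emod (const _)) (const _)
    (ite_lt (ediv (sum _ fun i => ((hx _).emod hF).mul (hF.pow _)) (const _))
      (hF.levelSeq (hF.sliceCapacity _ _) (hx _) _) (const _) (const _)) (const _))

end IsArith

/-! ### The main theorem -/

/-- The period of the grid colouring for window size `m`. -/
def gridPeriod (e b : ℕ) (m : ℤ) : ℤ :=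
  levelPeriod m (sliceCapacity e (b * (e + 1)) m) (b - 1)

/-- The number of occurrences of the colours belonging to direction `j`. -/
def directionCounts {e b : ℕ} (cnt : Fin (b * (e + 1) + 1) → ℤ) (j : Fin (e + 1)) (l : ℕ) : ℤ :=
  if h : l < b then cnt (Fin.castSucc ⟨colourIndex (j, (⟨l, h⟩ : Fin b)), colourIndex_lt _⟩) else 0

/-- The factor 2 in m makes the slice capacity even, as the parity code of sequence 0 requires. -/
theorem decodePosition_gridColouring {e b m g : ℕ} (hb : 0 < b) (hm : 0 < m)
    (hg : m = b * (e + 1 + 1) * (2 * g)) (x : Fin (e + 1 + 1) → ℤ) (j : Fin (e + 1 + 1)) :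
    decodePosition m (sliceCapacity (e + 1) (b * ((e + 1 : ℕ) + 1)) m)
      (directionCounts (fun c =>
        ((entryMultiset (windowPattern (gridColouring (e + 1) b m) m x)).count c : ℤ)) j) (b - 1) =
      x j % gridPeriod (e + 1) b m := by
  have hM := sliceCapacity_eq hm hg
  have hg0 : 0 < g := by
    rcases Nat.eq_zero_or_pos g with rfl | h
    · simp at hg; omega
    · exact h
  have hpos : 0 < sliceCapacity (e + 1) (b * ((e + 1 : ℕ) + 1)) m := by rw [hM]; positivity
  refine decodePosition_eq hm hpos (hM ▸ ⟨g * m ^ e, by push_cast; ring⟩) (x j) _ _ fun i hi => ?_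
  have hib : i < b := by omega
  rw [directionCounts, dif_pos hib]
  exact count_gridColouring hb hm hg x (j, ⟨i, hib⟩) _ rfl hpos

/-- The reserved colour and the slice codes depend on x only modulo m, which divides the period; the
level sequences all have the last level's period. -/
theorem colourValue_add_single {e b : ℕ} {m : ℤ} (hm : 0 < m)
    (hM : 0 < sliceCapacity e (b * (e + 1)) m) (hK : (b * (e + 1) : ℤ) ∣ m)
    (x : Fin (e + 1) → ℤ) (j : Fin (e + 1)) :
    colourValue b m (x + Pi.single j (gridPeriod e b m)) = colourValue b m x := by
  obtain ⟨y, hy⟩ : ∃ y : Fin (e + 1) → ℤ, y = x + Pi.single j (gridPeriod e b m) := ⟨_, rfl⟩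
  rw [← hy]
  have hmod : ∀ i, y i % m = x i % m := by
    intro i
    obtain ⟨z, hz⟩ := dvd_levelPeriod m (sliceCapacity e (b * (e + 1)) m) (b - 1)
    by_cases h : i = j
    · subst h
      rw [hy, Pi.add_apply, Pi.single_eq_same, gridPeriod, hz, Int.add_mul_emod_self_left]
    · rw [hy, Pi.add_apply, Pi.single_eq_of_ne h, add_zero]
  have hsum : (∑ i, y i) % (b * (e + 1)) =
      (∑ i, x i) % (b * (e + 1)) :=
    Int.ModEq.sum fun i _ => Int.ModEq.of_dvd hK (hmod i)
  have hcode : ∀ i, sliceCode m i y = sliceCode m i x :=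
    fun i => by simp only [sliceCode, hmod]
  unfold colourValue
  rw [hsum]
  congr 1
  refine Finset.sum_congr rfl fun p _ => ?_
  have hseq : levelSeq m (sliceCapacity e (b * (e + 1)) m) p.2
        (y p.1) =
      levelSeq m (sliceCapacity e (b * (e + 1)) m) p.2 (x p.1) := by
    by_cases h : p.1 = j
    · rw [hy, Pi.add_apply, h, Pi.single_eq_same]
      exact levelSeq_add_period hm hM (by omega) _
    · rw [hy, Pi.add_apply, Pi.single_eq_of_ne h, add_zero]
  rw [hcode, hseq]

/-- With y = m^d/K = mM the period is exactly y(y+1)^(b-1), and the 1 is negligible since y tends to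
infinity. -/
theorem gridPeriod_isEquivalent {e b : ℕ} (hb : 0 < b) :
    (fun m : ℕ => ((gridPeriod (e + 1) b m).toNat : ℝ))
      ~[atTop ⊓ 𝓟 {m : ℕ | 2 * (b * (e + 1 + 1)) ∣ m}]
      fun m : ℕ => (((m : ℝ) ^ (e + 1 + 1)) / (b * (e + 1 + 1) : ℕ)) ^ b := by
  have hK : (0 : ℝ) < (b * (e + 1 + 1) : ℕ) := by positivity
  set y : ℕ → ℝ := fun m => ((m : ℝ) ^ (e + 1 + 1)) / (b * (e + 1 + 1) : ℕ) with hy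
  set F := atTop ⊓ 𝓟 {m : ℕ | 2 * (b * (e + 1 + 1)) ∣ m}
  have hlim : Tendsto y F atTop :=
    (((tendsto_pow_atTop (by omega)).comp tendsto_natCast_atTop_atTop).atTop_div_const hK).mono_left
      inf_le_left
  have h1 : (fun m => y m + 1) ~[F] y :=
    IsEquivalent.refl.add_isLittleO
      ((isLittleO_const_left.mpr (Or.inr (tendsto_norm_atTop_atTop.comp hlim))))
  have h2 : (fun m => y m * (y m + 1) ^ (b - 1)) ~[F] fun m => y m ^ b := by
    have := (IsEquivalent.refl (u := y) (l := F)).mul (h1.pow (b - 1))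
    refine this.congr_right (Eventually.of_forall fun m => ?_)
    change y m * y m ^ (b - 1) = y m ^ b
    rw [← pow_succ', Nat.sub_add_cancel hb]
  refine h2.congr_left ?_
  have hmem : {m : ℕ | 2 * (b * (e + 1 + 1)) ∣ m} ∈ F := mem_inf_of_right (mem_principal_self _)
  filter_upwards [hmem, mem_inf_of_left (eventually_gt_atTop 0)] with m hdvd hm
  obtain ⟨g, hg⟩ := hdvd
  have hm' : 0 < m := hm
  have hg' : m = b * (e + 1 + 1) * (2 * g) := by rw [hg]; ring
  have hcap := sliceCapacity_eq hm' hg'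
  have hyM : y m = m * ((2 * g : ℕ) * m ^ e) := by
    have hgr : (m : ℝ) = (b * (e + 1 + 1) : ℕ) * (2 * g : ℕ) := by exact_mod_cast hg'
    rw [hy]
    simp only
    rw [div_eq_iff hK.ne', pow_succ]
    conv_lhs => rw [pow_succ]; arg 1; arg 2; rw [hgr]
    ring
  have hnn : 0 ≤ gridPeriod (e + 1) b m := by
    rw [gridPeriod, hcap, levelPeriod]; positivity
  have hcast : ((gridPeriod (e + 1) b m).toNat : ℝ) = ((gridPeriod (e + 1) b m : ℤ) : ℝ) := by
    exact_mod_cast congrArg (Int.cast : ℤ → ℝ) (Int.toNat_of_nonneg hnn)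
  rw [hcast, gridPeriod, hcap, levelPeriod, hyM]
  push_cast
  ring

theorem mainTheorem1 (d b k : ℕ) (hd : 2 ≤ d) (hb : 1 ≤ b) (hk : k = b * d + 1) :
    ∃ (n : ℕ → ℕ) (W : ℕ → (Fin d → ℤ) → Fin k),
      -- for every admissible window size `m`, `W m` is an `(n m, m, d, k)`-grid colouring
      (∀ m : ℕ, 0 < m → 2 * (k - 1) ∣ m → IsGridColouring (n m) m d k (W m)) ∧
      -- size asymptotics, as `m` tends to infinity through the multiples of `2 (k - 1)`
      ((fun m : ℕ => (n m : ℝ)) ~[atTop ⊓ 𝓟 {m : ℕ | 2 * (k - 1) ∣ m}]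
        (fun m : ℕ => ((1 / ((k : ℝ) - 1)) ^ (k - 1)) ^ (1 / (d : ℝ)) * (m : ℝ) ^ (k - 1))) ∧
      -- explicitness of the construction, and constant-time localization; the programs and the
      -- bound `K` depend on `d` and `k` only
      ∃ (sizeProg colourProg locateProg : Prog) (K : ℕ),
        ∀ m : ℕ, 0 < m → 2 * (k - 1) ∣ m →
          sizeProg.ComputesWithin K ![(m : ℤ)] ![(n m : ℤ)] ∧
          ∀ x : Fin d → ℤ,
            colourProg.ComputesWithin K (Fin.cons (m : ℤ) x : Fin (d + 1) → ℤ)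
              ![(((W m x : Fin k) : ℕ) : ℤ)] ∧
            locateProg.ComputesWithin K
              (Fin.cons (m : ℤ)
                (fun c : Fin k =>
                  (((entryMultiset (windowPattern (W m) m x)).count c : ℕ) : ℤ)) :
                Fin (k + 1) → ℤ)
              (fun j : Fin d => x j % (n m : ℤ)) := by
  obtain ⟨e, rfl⟩ : ∃ e, d = e + 1 + 1 := ⟨d - 2, by omega⟩
  subst hk
  have hfacts : ∀ m : ℕ, 0 < m → 2 * (b * (e + 1 + 1) + 1 - 1) ∣ m →
      ∃ g, m = b * (e + 1 + 1) * (2 * g) ∧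
        0 < sliceCapacity (e + 1) (b * ((e + 1 : ℕ) + 1)) m ∧
        (((gridPeriod (e + 1) b m).toNat : ℕ) : ℤ) = gridPeriod (e + 1) b m := by
    rintro m hm ⟨g, hg⟩
    rw [Nat.add_sub_cancel] at hg
    have hg' : m = b * (e + 1 + 1) * (2 * g) := by rw [hg]; ring
    have hg0 : 0 < g := by
      rcases Nat.eq_zero_or_pos g with rfl | h
      · simp at hg; omega
      · exact h
    have hM : 0 < sliceCapacity (e + 1) (b * ((e + 1 : ℕ) + 1)) m := by
      rw [sliceCapacity_eq hm hg']; positivity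
    exact ⟨g, hg', hM, Int.toNat_of_nonneg
      (levelPeriod_pos (by exact_mod_cast hm) hM _).le⟩
  refine ⟨fun m => (gridPeriod (e + 1) b m).toNat, fun m => gridColouring (e + 1) b m,
    fun m hm hdvd => ?_, ?_, ?_⟩
  · obtain ⟨g, hg, hM, hn⟩ := hfacts m hm hdvd
    refine ⟨fun x j => ?_, fun x y hxy j => ?_⟩
    · rw [hn]
      exact congrArg (fun z : ℤ => Fin.ofNat (b * (e + 1 + 1) + 1) z.toNat)
        (colourValue_add_single (by exact_mod_cast hm) hM ⟨2 * g, by exact_mod_cast hg⟩ x j)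
    -- Injectivity comes from the decoder: it sees only the multiset, and returns the position.
    · rw [hn, Int.ModEq, ← decodePosition_gridColouring hb hm hg x j, hxy,
        decodePosition_gridColouring hb hm hg y j]
  · have h := gridPeriod_isEquivalent (e := e) hb
    rw [Nat.add_sub_cancel]
    refine h.congr_right (Eventually.of_forall fun m => ?_)
    have e1 : ((b * (e + 1 + 1) + 1 : ℕ) : ℝ) - 1 = (b * (e + 1 + 1) : ℕ) := by push_cast; ring
    simp only
    -- The exponent k - 1 = bd makes the constant a d-th power, so its d-th root is (1/K)^b.
    rw [e1, pow_mul, one_div ((e + 1 + 1 : ℕ) : ℝ),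
      Real.pow_rpow_inv_natCast (by positivity) (by omega), div_eq_inv_mul, mul_pow, ← pow_mul,
      one_div, mul_comm (e + 1 + 1) b]
  · obtain ⟨P₁, K₁, h₁⟩ := exists_prog_of_isArith (p := 1) (q := 1)
      (F := fun v => ![gridPeriod (e + 1) b (v 0)]) fun i => by
        rw [Subsingleton.elim i 0]
        exact (IsArith.var 0).levelPeriod ((IsArith.var 0).sliceCapacity _ _) _
    obtain ⟨P₂, K₂, h₂⟩ := exists_prog_of_isArith (p := e + 1 + 1 + 1) (q := 1)
      (F := fun v => ![colourValue b (v 0) fun i : Fin (e + 1 + 1) => v i.succ]) fun i => by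
        rw [Subsingleton.elim i 0]
        exact IsArith.colourValue b (IsArith.var 0) fun i => IsArith.var i.succ
    obtain ⟨P₃, K₃, h₃⟩ := exists_prog_of_isArith (p := b * (e + 1 + 1) + 1 + 1) (q := e + 1 + 1)
      (F := fun v j => decodePosition (v 0)
        (sliceCapacity (e + 1) (b * ((e + 1 : ℕ) + 1)) (v 0))
        (directionCounts (fun c => v c.succ) j) (b - 1)) fun j => by
        refine (IsArith.var 0).decodePosition ((IsArith.var 0).sliceCapacity _ _) (fun l => ?_) _
        unfold directionCounts
        split_ifs
        · exact IsArith.var _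
        · exact IsArith.const 0
    refine ⟨P₁, P₂, P₃, K₁ + K₂ + K₃, fun m hm hdvd => ?_⟩
    obtain ⟨g, hg, hM, hn⟩ := hfacts m hm hdvd
    refine ⟨?_, fun x => ⟨?_, ?_⟩⟩
    · rw [hn]
      exact (h₁ ![(m : ℤ)]).mono (by omega)
    · rw [gridColouring_val hb]
      exact (h₂ (Fin.cons (m : ℤ) x)).mono (by omega)
    · have h := (h₃ (Fin.cons (m : ℤ) fun c =>
        (((entryMultiset (windowPattern (gridColouring (e + 1) b m) m x)).count c : ℕ) : ℤ))).mono
          (by omega : K₃ ≤ K₁ + K₂ + K₃)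
      simp only [Fin.cons_zero, Fin.cons_succ,
        decodePosition_gridColouring hb hm hg x] at h
      simpa only [hn] using h
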